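/- Let $\mathbb T$ be the unit circle, equipped with Lebesgue measure normalized to have total mass $1$, and let $\|\cdot\|_p$ denote the corresponding norm of $L^p(\mathbb T)$ (complex-valued functions). For $f\in L^2(\mathbb T)$ with Fourier series $f(\zeta)=\sum_{k\in\mathbb Z}\hat f(k)\zeta^k$, let $$P_1^+f(\zeta)=\sum_{k\ge 0}\hat f(k)\zeta^k$$ be its Riesz projection, the series converging in $L^2(\mathbb T)$. For $2\le p<\infty$ let $$\|P_1^+\|_{\infty,p}=\sup\{\|P_1^+f\|_p:\ f\in L^\infty(\mathbb T),\ \|f\|_\infty\le 1\}$$ be the norm of $P_1^+$ as an operator from $L^\infty(\mathbb T)$ to $L^p(\mathbb T)$. Then $\|P_1^+\|_{\infty,p}<\infty$ for every $2\le p<\infty$, and $$\lim_{p\to\infty}\frac{1}{p}\,\|P_1^+\|_{\infty,p}=\frac{1}{\pi e}.$$ -/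

import Mathlib

open MeasureTheory Filter Topology
open scoped ENNReal

noncomputable section

/-- The length `2π` of the circle is positive. -/
instance rieszCircle_fact : Fact ((0 : ℝ) < 2 * Real.pi) := ⟨Real.two_pi_pos⟩

/-- The unit circle `𝕋`, parametrized by the angle `θ` modulo `2π` (the point being
`ζ = exp (i θ)`); `fourier k θ` is then `ζ ^ k`. -/
abbrev RieszCircle : Type := AddCircle (2 * Real.pi)

/-- Lebesgue measure on the circle, normalized to have total mass `1`. -/
abbrev circleSigma : Measure RieszCircle := AddCircle.haarAddCircle

/-- The `k`-th term `hat f(k) ζ ^ k` of the Fourier series of `f`, as an element of `L²(𝕋)`. -/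
def fourierTerm (f : Lp ℂ 2 circleSigma) (k : ℤ) : Lp ℂ 2 circleSigma :=
  fourierCoeff (f : RieszCircle → ℂ) k • fourierLp 2 k

/-- The Riesz projection `P₁⁺ f = ∑_{k ≥ 0} hat f(k) ζ ^ k` on `L²(𝕋)`; the series converges
in the norm of `L²(𝕋)`, see `hasSum_rieszProjection`. -/
def rieszProjection (f : Lp ℂ 2 circleSigma) : Lp ℂ 2 circleSigma :=
  ∑' k : ℕ, fourierTerm f k

theorem hasSum_rieszProjection (f : Lp ℂ 2 circleSigma) :
    HasSum (fun k : ℕ => fourierTerm f k) (rieszProjection f) :=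
  ((hasSum_fourier_series_L2 f).summable.comp_injective Nat.cast_injective).hasSum

/-- The norm `‖P₁⁺‖_{q,p}` of the Riesz projection as an operator from `L^q(𝕋)` to `L^p(𝕋)`,
for `q ≥ 2` (so that `L^q(𝕋) ⊆ L²(𝕋)`): the supremum of `‖P₁⁺ f‖_p` over all complex-valued
`f` with `‖f‖_q ≤ 1`, as an extended nonnegative number, equal to `∞` exactly when the operator
is unbounded or does not map into `L^p(𝕋)`. -/
def rieszNorm (q p : ℝ≥0∞) : ℝ≥0∞ :=
  ⨆ (f : Lp ℂ 2 circleSigma) (_ : eLpNorm f q circleSigma ≤ 1),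
    eLpNorm (rieszProjection f) p circleSigma

end

/-!
Let `g(z) = ∑_{k ≥ 0} f̂(k) z ^ k` be the analytic part of a function `f` on the circle with
`|f| ≤ 1`, so that `P₁⁺ f` is the boundary value of `g`.

*Upper bound.* The critical exponent `π` of exponential integrability of `P₁⁺ f` gives the
constant `1 / (π e)`. If `u` is real with `|u| ≤ 1` and `F` is its Schwarz integral, then
`|Re F| ≤ 1`, since the Poisson kernel is positive with mass one. The mean value property for
`exp (-i c F)`, whose real part is at least `cos c * exp (c Im F)`, bounds the means of
`exp (c Im F)` by `1 / cos c` for every `c < π / 2`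
(`integral_exp_im_schwarzIntegral_le`). For complex `f`, `2 |g|` is at most `2` plus the modulus
of the conjugate function of `f`. Up to a factor close to `1`, that modulus is the largest among
the conjugate functions of `Re (s̄ f)` for finitely many unimodular `s`
(`exists_norm_analyticPart_le`). Summing over `s` bounds the means of `exp (a |g|)` on circles of
radius less than `1`, for every `a < π`. By Parseval the Abel means of `P₁⁺ f` converge in `L²`,
and Fatou's lemma transfers the bound to the boundary: `∫ exp (a |P₁⁺ f|) ≤ C_a`. Finally
`x ^ p ≤ (p / (a e)) ^ p * exp (a x)` gives `‖P₁⁺ f‖_p ≤ p / (a e) * C_a ^ (1 / p)`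
(`exists_rieszNorm_top_le`).

*Lower bound.* The sawtooth function `(π - θ) / π` has Riesz projection
`-(π i)⁻¹ log (1 - ζ)`, of modulus at least `p / π` where `|θ| ≤ e⁻ᵖ`. That arc has measure
`e⁻ᵖ / π`, and Chebyshev's inequality gives `‖P₁⁺‖_{∞,p} ≥ p / (π e) * π ^ (-1 / p)`
(`le_rieszNorm_top`).
-/

noncomputable section

open scoped ComplexConjugate

/-! ### The analytic part and the Schwarz integral -/

/-- The sum `∑_{k ≥ 0} û(k) z ^ k`: the extension to the unit disc of the Riesz projection of
`u`. -/
def analyticPart (u : RieszCircle → ℂ) (z : ℂ) : ℂ :=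
  ∑' k : ℕ, fourierCoeff u k * z ^ k

/-- The Schwarz integral `û(0) + 2 ∑_{k ≥ 1} û(k) z ^ k` of `u`. For real `u`, its real part is
the Poisson integral of `u` and its imaginary part the harmonic conjugate. -/
def schwarzIntegral (u : RieszCircle → ℂ) (z : ℂ) : ℂ :=
  2 * analyticPart u z - fourierCoeff u 0

/-- The Schwarz kernel `(1 + w) / (1 - w)` with `w = z e^{-it}`; its real part is the Poisson
kernel. -/
def schwarzKernel (z : ℂ) (t : RieszCircle) : ℂ :=
  (1 + z * fourier (-1) t) / (1 - z * fourier (-1) t)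

theorem norm_fourier_apply (n : ℤ) (t : RieszCircle) : ‖fourier n t‖ = 1 := by
  rw [fourier_apply]; exact Circle.norm_coe _

theorem fourier_neg_natCast_apply (k : ℕ) (t : RieszCircle) :
    fourier (-(k : ℤ)) t = fourier (-1) t ^ k := by
  induction k with
  | zero => simp
  | succ k ih => rw [pow_succ, ← ih, ← fourier_add]; congr 2; push_cast; ring

theorem fourier_natCast_apply (k : ℕ) (t : RieszCircle) :
    fourier (k : ℤ) t = fourier 1 t ^ k := by
  induction k with
  | zero => simp
  | succ k ih => rw [pow_succ, ← ih, ← fourier_add]; congr 2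

section Bounded

variable {u : RieszCircle → ℂ}

theorem norm_fourierCoeff_le_one (hu : ∀ᵐ t ∂circleSigma, ‖u t‖ ≤ 1) (n : ℤ) :
    ‖fourierCoeff u n‖ ≤ 1 := by
  unfold fourierCoeff
  refine (norm_integral_le_of_norm_le_const (C := 1) ?_).trans (by simp)
  filter_upwards [hu] with t ht
  rw [norm_smul, norm_fourier_apply, one_mul]
  exact ht

theorem differentiableOn_analyticPart (hu : ∀ᵐ t ∂circleSigma, ‖u t‖ ≤ 1) :
    DifferentiableOn ℂ (analyticPart u) (Metric.ball 0 1) := by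
  intro z hz
  obtain ⟨ρ, hzρ, hρ⟩ := exists_between (mem_ball_zero_iff.1 hz)
  have hρ0 : 0 ≤ ρ := (norm_nonneg z).trans hzρ.le
  have key : DifferentiableOn ℂ (analyticPart u) (Metric.ball 0 ρ) := by
    refine Complex.differentiableOn_tsum_of_summable_norm (u := fun k : ℕ => ρ ^ k)
      (summable_geometric_of_lt_one hρ0 hρ) (fun k => by fun_prop) Metric.isOpen_ball ?_
    intro k w hw
    rw [norm_mul, norm_pow]
    calc _ ≤ 1 * ρ ^ k := by
          gcongr
          · exact norm_fourierCoeff_le_one hu k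
          · exact (mem_ball_zero_iff.1 hw).le
      _ = ρ ^ k := one_mul _
  exact ((key z (mem_ball_zero_iff.2 hzρ)).differentiableAt
    (Metric.isOpen_ball.mem_nhds (mem_ball_zero_iff.2 hzρ))).differentiableWithinAt

theorem differentiableOn_schwarzIntegral (hu : ∀ᵐ t ∂circleSigma, ‖u t‖ ≤ 1) :
    DifferentiableOn ℂ (schwarzIntegral u) (Metric.ball 0 1) :=
  ((differentiableOn_analyticPart hu).const_mul 2).sub_const _

theorem norm_mul_fourier_lt_one {z : ℂ} (hz : ‖z‖ < 1) (n : ℤ) (t : RieszCircle) :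
    ‖z * fourier n t‖ < 1 := by
  rwa [norm_mul, norm_fourier_apply, mul_one]

theorem one_sub_mul_fourier_ne_zero {z : ℂ} (hz : ‖z‖ < 1) (n : ℤ) (t : RieszCircle) :
    1 - z * fourier n t ≠ 0 := fun h => by
  have := norm_mul_fourier_lt_one hz n t
  rw [← sub_eq_zero.1 h] at this
  simp at this

theorem continuous_cauchyKernel {z : ℂ} (hz : ‖z‖ < 1) :
    Continuous fun t : RieszCircle => (1 - z * fourier (-1) t)⁻¹ :=
  Continuous.inv₀ (by fun_prop) (one_sub_mul_fourier_ne_zero hz (-1))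

theorem continuous_schwarzKernel {z : ℂ} (hz : ‖z‖ < 1) : Continuous (schwarzKernel z) :=
  Continuous.div (by fun_prop) (by fun_prop) (one_sub_mul_fourier_ne_zero hz (-1))

theorem integrable_mul_of_continuous (hm : AEStronglyMeasurable u circleSigma)
    (hu : ∀ᵐ t ∂circleSigma, ‖u t‖ ≤ 1) {g : RieszCircle → ℂ} (hg : Continuous g) :
    Integrable (fun t => u t * g t) circleSigma :=
  (hg.integrable_of_hasCompactSupport (HasCompactSupport.of_compactSpace _)).bdd_mul hm hu

/-- Cauchy's integral for the analytic part. -/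
theorem analyticPart_eq_integral (hm : AEStronglyMeasurable u circleSigma)
    (hu : ∀ᵐ t ∂circleSigma, ‖u t‖ ≤ 1) {z : ℂ} (hz : ‖z‖ < 1) :
    analyticPart u z = ∫ t, u t * (1 - z * fourier (-1) t)⁻¹ ∂circleSigma := by
  have hs := summable_geometric_of_lt_one (norm_nonneg z) hz
  have key := hasSum_integral_of_dominated_convergence (μ := circleSigma)
    (F := fun (k : ℕ) t => u t * (z * fourier (-1) t) ^ k)
    (f := fun t => u t * (1 - z * fourier (-1) t)⁻¹) (fun k _ => ‖z‖ ^ k) ?_ ?_ ?_ ?_ ?_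
  · rw [analyticPart, ← key.tsum_eq]
    congr 1 with k
    rw [fourierCoeff, ← integral_mul_const]
    congr 1 with t
    rw [fourier_neg_natCast_apply, smul_eq_mul]
    ring
  · intro k
    exact hm.mul (Continuous.aestronglyMeasurable (by fun_prop))
  · intro k
    filter_upwards [hu] with t ht
    rw [norm_mul, norm_pow, norm_mul, norm_fourier_apply, mul_one]
    exact mul_le_of_le_one_left (by positivity) ht
  · exact .of_forall fun _ => hs
  · exact integrable_const _
  · exact .of_forall fun t =>
      (hasSum_geometric_of_norm_lt_one (norm_mul_fourier_lt_one hz (-1) t)).mul_left _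

theorem schwarzIntegral_eq_integral (hm : AEStronglyMeasurable u circleSigma)
    (hu : ∀ᵐ t ∂circleSigma, ‖u t‖ ≤ 1) {z : ℂ} (hz : ‖z‖ < 1) :
    schwarzIntegral u z = ∫ t, u t * schwarzKernel z t ∂circleSigma := by
  have h0 : fourierCoeff u 0 = ∫ t, u t * 1 ∂circleSigma := by simp [fourierCoeff]
  rw [schwarzIntegral, analyticPart_eq_integral hm hu hz, h0, ← integral_const_mul,
    ← integral_sub ((integrable_mul_of_continuous hm hu (continuous_cauchyKernel hz)).const_mul 2)
      (integrable_mul_of_continuous hm hu continuous_const)]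
  congr 1 with t
  have := one_sub_mul_fourier_ne_zero hz (-1) t
  rw [schwarzKernel]
  field_simp
  ring

end Bounded

theorem schwarzKernel_re_pos {z : ℂ} (hz : ‖z‖ < 1) (t : RieszCircle) :
    0 < (schwarzKernel z t).re := by
  have hw := norm_mul_fourier_lt_one hz (-1) t
  have hne := one_sub_mul_fourier_ne_zero hz (-1) t
  rw [schwarzKernel]
  set w := z * fourier (-1) t
  have hsq : w.re * w.re + w.im * w.im < 1 := by
    rw [← Complex.normSq_apply, Complex.normSq_eq_norm_sq]
    exact pow_lt_one₀ (norm_nonneg _) hw two_ne_zero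
  rw [Complex.div_re, ← add_div]
  refine div_pos ?_ (Complex.normSq_pos.2 hne)
  simp
  nlinarith

theorem integral_schwarzKernel {z : ℂ} (hz : ‖z‖ < 1) :
    ∫ t, schwarzKernel z t ∂circleSigma = 1 := by
  have hc : fourierCoeff (fun _ : RieszCircle => (1 : ℂ)) = Pi.single 0 1 := by
    rw [← fourierCoeff_fourier (T := 2 * Real.pi) 0]
    congr 1 with t
    simp
  have h := schwarzIntegral_eq_integral (u := fun _ => 1) aestronglyMeasurable_const
    (.of_forall fun _ => by simp) hz
  simp only [one_mul] at h
  rw [← h, schwarzIntegral, analyticPart, tsum_eq_single 0]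
  · simp [hc]; norm_num
  · intro k hk
    simp [hc, hk]

theorem integrable_schwarzKernel {z : ℂ} (hz : ‖z‖ < 1) :
    Integrable (schwarzKernel z) circleSigma :=
  (continuous_schwarzKernel hz).integrable_of_hasCompactSupport
    (HasCompactSupport.of_compactSpace _)

theorem integral_re_schwarzKernel {z : ℂ} (hz : ‖z‖ < 1) :
    ∫ t, (schwarzKernel z t).re ∂circleSigma = 1 := by
  have := integral_re (integrable_schwarzKernel hz)
  rw [integral_schwarzKernel hz] at this
  simpa using this

section Real

variable {u : RieszCircle → ℝ}

/-- The Schwarz integral maps real functions bounded by `1` to functions with real part bounded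
by `1`, because the Poisson kernel is positive with total mass `1`. -/
theorem abs_re_schwarzIntegral_le_one (hm : AEStronglyMeasurable u circleSigma)
    (hu : ∀ᵐ t ∂circleSigma, |u t| ≤ 1) {z : ℂ} (hz : ‖z‖ < 1) :
    |(schwarzIntegral (fun t => (u t : ℂ)) z).re| ≤ 1 := by
  have hm' : AEStronglyMeasurable (fun t => (u t : ℂ)) circleSigma :=
    Complex.continuous_ofReal.comp_aestronglyMeasurable hm
  have hu' : ∀ᵐ t ∂circleSigma, ‖(u t : ℂ)‖ ≤ 1 := by simpa using hu
  have hint := integrable_mul_of_continuous hm' hu' (continuous_schwarzKernel hz)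
  rw [schwarzIntegral_eq_integral hm' hu' hz, ← RCLike.re_eq_complex_re, ← integral_re hint,
    ← Real.norm_eq_abs]
  rw [← integral_re_schwarzKernel hz]
  refine norm_integral_le_of_norm_le (integrable_schwarzKernel hz).re ?_
  filter_upwards [hu] with t ht
  have hpos := schwarzKernel_re_pos hz t
  simp only [RCLike.re_eq_complex_re, Complex.re_ofReal_mul, Real.norm_eq_abs, abs_mul,
    abs_of_pos hpos]
  exact mul_le_of_le_one_left hpos.le ht

theorem im_schwarzIntegral (hm : AEStronglyMeasurable u circleSigma)
    (hu : ∀ᵐ t ∂circleSigma, |u t| ≤ 1) {z : ℂ} (hz : ‖z‖ < 1) :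
    (schwarzIntegral (fun t => (u t : ℂ)) z).im
      = ∫ t, u t * (schwarzKernel z t).im ∂circleSigma := by
  have hm' : AEStronglyMeasurable (fun t => (u t : ℂ)) circleSigma :=
    Complex.continuous_ofReal.comp_aestronglyMeasurable hm
  have hu' : ∀ᵐ t ∂circleSigma, ‖(u t : ℂ)‖ ≤ 1 := by simpa using hu
  have hint := integrable_mul_of_continuous hm' hu' (continuous_schwarzKernel hz)
  rw [schwarzIntegral_eq_integral hm' hu' hz, ← RCLike.im_eq_complex_im, ← integral_im hint]
  simp

end Real

/-! ### Exponential integrability of the conjugate function -/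

/-- The mean value property on the circle of radius `r < 1`. -/
theorem integral_mul_fourier_one {F : ℂ → ℂ} (hF : DifferentiableOn ℂ F (Metric.ball 0 1))
    {r : ℝ} (hr0 : 0 ≤ r) (hr : r < 1) :
    ∫ t : RieszCircle, F (r * fourier 1 t) ∂circleSigma = F 0 := by
  have hsub : Metric.closedBall (0 : ℂ) |r| ⊆ Metric.ball 0 1 :=
    Metric.closedBall_subset_ball (by rwa [abs_of_nonneg hr0])
  have hdc : DiffContOnCl ℂ F (Metric.ball 0 |r|) :=
    (hF.mono (Metric.closure_ball_subset_closedBall.trans hsub)).diffContOnCl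
  rw [← hdc.circleAverage, Real.circleAverage_def, AddCircle.integral_haarAddCircle,
    ← AddCircle.intervalIntegral_preimage (2 * Real.pi) 0, zero_add]
  congr 1
  refine intervalIntegral.integral_congr fun x _ => ?_
  simp only [fourier_coe_apply, circleMap, zero_add]
  congr 3
  push_cast
  field_simp

theorem continuous_comp_mul_fourier_one {F : ℂ → ℂ}
    (hF : DifferentiableOn ℂ F (Metric.ball 0 1)) {r : ℝ} (hr0 : 0 ≤ r) (hr : r < 1) :
    Continuous fun t : RieszCircle => F (r * fourier 1 t) :=
  hF.continuousOn.comp_continuous (by fun_prop) fun t => mem_ball_zero_iff.2 <|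
    norm_mul_fourier_lt_one (by simpa [abs_of_nonneg hr0] using hr) 1 t

/-- Exponential integrability of the conjugate function: `exp (-i c F)`, with `F` the Schwarz
integral of `u`, has modulus `exp (c Im F)` and argument `-c Re F` in `[-c, c]`, so its real part
is at least `cos c * exp (c Im F)`, while the mean of the real part is at most `1`. -/
theorem integral_exp_im_schwarzIntegral_le {u : RieszCircle → ℝ}
    (hm : AEStronglyMeasurable u circleSigma) (hu : ∀ᵐ t ∂circleSigma, |u t| ≤ 1)
    {c : ℝ} (hc0 : 0 ≤ c) (hc : c < Real.pi / 2) {r : ℝ} (hr0 : 0 ≤ r) (hr : r < 1) :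
    ∫ t, Real.exp (c * (schwarzIntegral (fun t => (u t : ℂ)) (r * fourier 1 t)).im) ∂circleSigma
      ≤ (Real.cos c)⁻¹ := by
  have hu' : ∀ᵐ t ∂circleSigma, ‖(u t : ℂ)‖ ≤ 1 := by simpa using hu
  set F := schwarzIntegral (fun t => (u t : ℂ))
  have hF : DifferentiableOn ℂ F (Metric.ball 0 1) := differentiableOn_schwarzIntegral hu'
  have hcos : 0 < Real.cos c := Real.cos_pos_of_mem_Ioo ⟨by linarith [Real.pi_pos], hc⟩
  have hE : DifferentiableOn ℂ (fun z => Complex.exp (-(Complex.I * c * F z))) (Metric.ball 0 1) :=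
    ((hF.const_mul _).neg).cexp
  have hEc := continuous_comp_mul_fourier_one hE hr0 hr
  have hFc := continuous_comp_mul_fourier_one hF hr0 hr
  have hre : ∀ w : ℂ, (Complex.exp (-(Complex.I * c * w))).re
      = Real.exp (c * w.im) * Real.cos (c * w.re) := by
    intro w
    rw [Complex.exp_re]
    simp
  have hmean := integral_mul_fourier_one hE hr0 hr
  have hEi : Integrable (fun t : RieszCircle =>
      Complex.exp (-(Complex.I * c * F (r * fourier 1 t)))) circleSigma :=
    hEc.integrable_of_hasCompactSupport (HasCompactSupport.of_compactSpace _)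
  have hmean' := integral_re hEi
  rw [hmean] at hmean'
  simp only [RCLike.re_eq_complex_re, hre] at hmean'
  have him : (F 0).im = 0 := by
    rw [im_schwarzIntegral hm hu (by simp)]
    simp [schwarzKernel]
  rw [him, mul_zero, Real.exp_zero, one_mul] at hmean'
  have hbound : ∀ t : RieszCircle, Real.cos c ≤ Real.cos (c * (F (r * fourier 1 t)).re) := by
    intro t
    have h1 := abs_re_schwarzIntegral_le_one hm hu
      (norm_mul_fourier_lt_one (z := (r : ℂ)) (by simpa [abs_of_nonneg hr0] using hr) 1 t)
    rw [← Real.cos_abs (c * _)]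
    refine Real.cos_le_cos_of_nonneg_of_le_pi (abs_nonneg _) (by linarith [Real.pi_pos]) ?_
    rw [abs_mul, abs_of_nonneg hc0]
    exact mul_le_of_le_one_right hc0 h1
  clear_value F
  have hFre := Complex.continuous_re.comp hFc
  have hFim := Complex.continuous_im.comp hFc
  simp only [Function.comp_def] at hFre hFim
  have hle : (∫ t, Real.exp (c * (F (r * fourier 1 t)).im) ∂circleSigma) * Real.cos c ≤ 1 := by
    rw [← integral_mul_const]
    refine (integral_mono ?_ ?_ fun t => ?_).trans (hmean'.le.trans (Real.cos_le_one _))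
    · exact Continuous.integrable_of_hasCompactSupport (by fun_prop)
        (HasCompactSupport.of_compactSpace _)
    · exact Continuous.integrable_of_hasCompactSupport (by fun_prop)
        (HasCompactSupport.of_compactSpace _)
    · exact mul_le_mul_of_nonneg_left (hbound t) (Real.exp_pos _).le
  rwa [← one_div, le_div_iff₀ hcos]

theorem continuous_exp_im_schwarzIntegral {u : RieszCircle → ℝ}
    (hu : ∀ᵐ t ∂circleSigma, |u t| ≤ 1) (c : ℝ) {r : ℝ} (hr0 : 0 ≤ r) (hr : r < 1) :
    Continuous fun t : RieszCircle =>
      Real.exp (c * (schwarzIntegral (fun t => (u t : ℂ)) (r * fourier 1 t)).im) := by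
  have hFc := continuous_comp_mul_fourier_one (differentiableOn_schwarzIntegral
    (u := fun t => (u t : ℂ)) (by simpa using hu)) hr0 hr
  exact Real.continuous_exp.comp (continuous_const.mul (Complex.continuous_im.comp hFc))

theorem lintegral_exp_im_schwarzIntegral_le {u : RieszCircle → ℝ}
    (hm : AEStronglyMeasurable u circleSigma) (hu : ∀ᵐ t ∂circleSigma, |u t| ≤ 1)
    {c : ℝ} (hc0 : 0 ≤ c) (hc : c < Real.pi / 2) {r : ℝ} (hr0 : 0 ≤ r) (hr : r < 1) :
    ∫⁻ t, ENNReal.ofReal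
        (Real.exp (c * (schwarzIntegral (fun t => (u t : ℂ)) (r * fourier 1 t)).im)) ∂circleSigma
      ≤ ENNReal.ofReal (Real.cos c)⁻¹ := by
  rw [← ofReal_integral_eq_lintegral_ofReal
    ((continuous_exp_im_schwarzIntegral hu c hr0 hr).integrable_of_hasCompactSupport
      (HasCompactSupport.of_compactSpace _))
    (.of_forall fun t => (Real.exp_pos _).le)]
  exact ENNReal.ofReal_le_ofReal (integral_exp_im_schwarzIntegral_le hm hu hc0 hc hr0 hr)

/-! ### From real to complex functions -/

/-- Finitely many directions detect the modulus of a complex number up to a factor close to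
`1`. -/
theorem exists_finset_directions {ε : ℝ} (hε : 0 < ε) :
    ∃ S : Finset ℂ, (∀ s ∈ S, ‖s‖ = 1) ∧
      ∀ z : ℂ, ∃ s ∈ S, (1 - ε) * ‖z‖ ≤ (conj s * z).re := by
  obtain ⟨t, hts, htf, hcov⟩ := (isCompact_sphere (0 : ℂ) 1).finite_cover_balls hε
  refine ⟨htf.toFinset, fun s hs => by simpa using hts (htf.mem_toFinset.1 hs), ?_⟩
  have key : ∀ w : ℂ, ‖w‖ = 1 → ∃ s ∈ htf.toFinset, (1 - ε) ≤ (conj s * w).re := by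
    intro w hw
    obtain ⟨s, hs, hsw⟩ := Set.mem_iUnion₂.1 (hcov (by simpa using hw : w ∈ Metric.sphere (0 : ℂ) 1))
    refine ⟨s, htf.mem_toFinset.2 hs, ?_⟩
    have hww : conj w * w = 1 := by
      rw [Complex.conj_mul', hw]; simp
    have hre : (conj s * w).re = 1 - (conj (w - s) * w).re := by
      rw [map_sub, sub_mul, hww]; simp
    have hn : (conj (w - s) * w).re ≤ ε := by
      refine (Complex.re_le_norm _).trans ?_
      rw [norm_mul, hw, mul_one, RCLike.norm_conj, ← dist_eq_norm]
      exact (Metric.mem_ball.1 hsw).le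
    linarith
  intro z
  rcases eq_or_ne z 0 with rfl | hz
  · obtain ⟨s, hs, -⟩ := key 1 (by simp)
    exact ⟨s, hs, by simp⟩
  · have hz' : 0 < ‖z‖ := norm_pos_iff.2 hz
    obtain ⟨s, hs, h⟩ := key ((‖z‖⁻¹ : ℝ) * z) (by simp [hz])
    refine ⟨s, hs, ?_⟩
    have : (conj s * ((‖z‖⁻¹ : ℝ) * z)).re = ‖z‖⁻¹ * (conj s * z).re := by
      rw [← Complex.re_ofReal_mul]; congr 1; ring
    rw [this, inv_mul_eq_div, le_div_iff₀ hz'] at h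
    exact h

section Complex

variable {f : RieszCircle → ℂ}

theorem ae_abs_re_conj_mul_le_one (hf : ∀ᵐ t ∂circleSigma, ‖f t‖ ≤ 1) {s : ℂ} (hs : ‖s‖ = 1) :
    ∀ᵐ t ∂circleSigma, |(conj s * f t).re| ≤ 1 := by
  filter_upwards [hf] with t ht
  refine (Complex.abs_re_le_norm _).trans ?_
  rwa [norm_mul, RCLike.norm_conj, hs, one_mul]

theorem aestronglyMeasurable_re_conj_mul (hm : AEStronglyMeasurable f circleSigma) (s : ℂ) :
    AEStronglyMeasurable (fun t => (conj s * f t).re) circleSigma :=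
  Complex.continuous_re.comp_aestronglyMeasurable (hm.const_mul _)

/-- Up to an additive constant, the analytic part of a function bounded by `1` is at most half of
its conjugate function, which is controlled by the conjugate functions of the real functions
`Re (s̄ f)` for finitely many directions `s`. -/
theorem exists_norm_analyticPart_le (hm : AEStronglyMeasurable f circleSigma)
    (hf : ∀ᵐ t ∂circleSigma, ‖f t‖ ≤ 1) {ε : ℝ} {S : Finset ℂ}
    (hS : ∀ s ∈ S, ‖s‖ = 1) (hSz : ∀ z : ℂ, ∃ s ∈ S, (1 - ε) * ‖z‖ ≤ (conj s * z).re)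
    (hε : ε < 1) {z : ℂ} (hz : ‖z‖ < 1) :
    ∃ s ∈ S, 2 * ‖analyticPart f z‖ ≤
      2 + (1 - ε)⁻¹ * (schwarzIntegral (fun t => ((conj s * f t).re : ℂ)) z).im := by
  have hK := integrable_schwarzKernel hz
  have hKre : Integrable (fun t => f t * ((schwarzKernel z t).re : ℂ)) circleSigma :=
    integrable_mul_of_continuous hm hf (by have := continuous_schwarzKernel hz; fun_prop)
  have hKim : Integrable (fun t => f t * ((schwarzKernel z t).im : ℂ)) circleSigma :=
    integrable_mul_of_continuous hm hf (by have := continuous_schwarzKernel hz; fun_prop)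
  set H := ∫ t, f t * ((schwarzKernel z t).im : ℂ) ∂circleSigma
  set P := ∫ t, f t * ((schwarzKernel z t).re : ℂ) ∂circleSigma
  have hsplit : schwarzIntegral f z = P + H * Complex.I := by
    rw [schwarzIntegral_eq_integral hm hf hz, ← integral_mul_const,
      ← integral_add hKre (hKim.mul_const _)]
    congr 1 with t
    conv_lhs => rw [← Complex.re_add_im (schwarzKernel z t)]
    ring
  have hP : ‖P‖ ≤ 1 := by
    rw [← integral_re_schwarzKernel hz]
    refine norm_integral_le_of_norm_le hK.re ?_
    filter_upwards [hf] with t ht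
    have hpos := schwarzKernel_re_pos hz t
    rw [norm_mul, Complex.norm_real, Real.norm_eq_abs, abs_of_pos hpos]
    exact mul_le_of_le_one_left hpos.le ht
  obtain ⟨s, hs, hsH⟩ := hSz H
  refine ⟨s, hs, ?_⟩
  have him : (conj s * H).re = (schwarzIntegral (fun t => ((conj s * f t).re : ℂ)) z).im := by
    rw [im_schwarzIntegral (aestronglyMeasurable_re_conj_mul hm s)
      (ae_abs_re_conj_mul_le_one hf (hS s hs)) hz, ← integral_const_mul,
      ← RCLike.re_eq_complex_re, ← integral_re (hKim.const_mul _)]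
    congr 1 with t
    rw [← mul_assoc, RCLike.re_eq_complex_re, Complex.re_mul_ofReal]
  rw [← him]
  have h0 := norm_fourierCoeff_le_one hf 0
  have h2 : 2 * analyticPart f z = P + H * Complex.I + fourierCoeff f 0 := by
    rw [← hsplit, schwarzIntegral]; ring
  have hHle : ‖H‖ ≤ (1 - ε)⁻¹ * (conj s * H).re := by
    rw [inv_mul_eq_div, le_div_iff₀ (by linarith), mul_comm]; exact hsH
  calc 2 * ‖analyticPart f z‖ = ‖2 * analyticPart f z‖ := by simp
    _ = ‖P + H * Complex.I + fourierCoeff f 0‖ := by rw [h2]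
    _ ≤ ‖P‖ + ‖H * Complex.I‖ + ‖fourierCoeff f 0‖ := norm_add₃_le
    _ = ‖P‖ + ‖H‖ + ‖fourierCoeff f 0‖ := by simp
    _ ≤ _ := by linarith

end Complex

/-- For every `a < π`, the exponential integral `∫ exp (a |g|)` over circles of radius `r < 1` is
bounded uniformly in `r` and in `g = analyticPart f` with `|f| ≤ 1`. -/
theorem exists_lintegral_exp_analyticPart_le {a : ℝ} (ha0 : 0 < a) (ha : a < Real.pi) :
    ∃ C : ℝ, 0 < C ∧ ∀ f : RieszCircle → ℂ, AEStronglyMeasurable f circleSigma →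
      (∀ᵐ t ∂circleSigma, ‖f t‖ ≤ 1) → ∀ r : ℝ, 0 ≤ r → r < 1 →
      ∫⁻ t, ENNReal.ofReal (Real.exp (a * ‖analyticPart f (r * fourier 1 t)‖)) ∂circleSigma
        ≤ ENNReal.ofReal C := by
  have hpi := Real.pi_pos
  -- The loss `1 - ε` in the choice of directions is absorbed by `a < π`.
  obtain ⟨c, hac, hc⟩ := exists_between (show a / 2 < Real.pi / 2 by linarith)
  have hc0 : 0 < c := by linarith
  set ε : ℝ := 1 - a / (2 * c) with hεdef
  have hε1 : 1 - ε = a / (2 * c) := by rw [hεdef]; ring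
  have hε : 0 < ε := by
    rw [hεdef, sub_pos, div_lt_one (by positivity)]; linarith
  have hε' : ε < 1 := by
    have : 0 < a / (2 * c) := by positivity
    linarith
  obtain ⟨S, hS, hSz⟩ := exists_finset_directions hε
  have hcos : 0 < Real.cos c := Real.cos_pos_of_mem_Ioo ⟨by linarith, hc⟩
  have hSne : 0 < S.card := by
    obtain ⟨s, hs, -⟩ := hSz 0
    exact Finset.card_pos.2 ⟨s, hs⟩
  refine ⟨S.card * (Real.exp a * (Real.cos c)⁻¹), by positivity, ?_⟩
  intro f hm hf r hr0 hr
  have hz : ∀ t : RieszCircle, ‖(r : ℂ) * fourier 1 t‖ < 1 :=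
    norm_mul_fourier_lt_one (by simpa [abs_of_nonneg hr0] using hr) 1
  set G : ℂ → RieszCircle → ℝ := fun s t =>
    Real.exp (c * (schwarzIntegral (fun t => ((conj s * f t).re : ℂ)) (r * fourier 1 t)).im)
  have hG : ∀ s t, 0 < G s t := fun s t => Real.exp_pos _
  have hpt : ∀ t : RieszCircle,
      ENNReal.ofReal (Real.exp (a * ‖analyticPart f (r * fourier 1 t)‖))
        ≤ ∑ s ∈ S, ENNReal.ofReal (Real.exp a) * ENNReal.ofReal (G s t) := by
    intro t
    obtain ⟨s, hs, hle⟩ := exists_norm_analyticPart_le hm hf hS hSz hε' (hz t)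
    refine le_trans ?_ (Finset.single_le_sum (f := fun s =>
      ENNReal.ofReal (Real.exp a) * ENNReal.ofReal (G s t)) (fun _ _ => zero_le) hs)
    rw [← ENNReal.ofReal_mul (Real.exp_pos a).le, ← Real.exp_add]
    refine ENNReal.ofReal_le_ofReal (Real.exp_le_exp.2 ?_)
    rw [hε1, inv_div] at hle
    have := mul_le_mul_of_nonneg_left hle (show 0 ≤ a / 2 by positivity)
    calc _ = a / 2 * (2 * ‖analyticPart f (r * fourier 1 t)‖) := by ring
      _ ≤ _ := this
      _ = _ := by field_simp
  have hGm : ∀ s ∈ S, Measurable fun t => ENNReal.ofReal (G s t) := by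
    intro s hs
    exact (ENNReal.continuous_ofReal.comp (continuous_exp_im_schwarzIntegral
      (ae_abs_re_conj_mul_le_one hf (hS s hs)) c hr0 hr)).measurable
  calc _ ≤ ∫⁻ t, ∑ s ∈ S, ENNReal.ofReal (Real.exp a) * ENNReal.ofReal (G s t) ∂circleSigma :=
        lintegral_mono hpt
    _ = ∑ s ∈ S, ENNReal.ofReal (Real.exp a) * ∫⁻ t, ENNReal.ofReal (G s t) ∂circleSigma := by
        rw [lintegral_finsetSum' _ fun s hs => ((hGm s hs).const_mul _).aemeasurable]
        exact Finset.sum_congr rfl fun s hs => lintegral_const_mul _ (hGm s hs)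
    _ ≤ ∑ _s ∈ S, ENNReal.ofReal (Real.exp a) * ENNReal.ofReal (Real.cos c)⁻¹ := by
        refine Finset.sum_le_sum fun s hs => ?_
        gcongr
        exact lintegral_exp_im_schwarzIntegral_le (aestronglyMeasurable_re_conj_mul hm s)
          (ae_abs_re_conj_mul_le_one hf (hS s hs)) hc0.le hc hr0 hr
    _ = _ := by
        rw [Finset.sum_const, ← ENNReal.ofReal_mul (Real.exp_pos a).le, nsmul_eq_mul,
          ENNReal.ofReal_mul (p := (S.card : ℝ)) (by positivity), ENNReal.ofReal_natCast]

/-! ### Abel summation of the Riesz projection -/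

theorem Orthonormal.hasSum_norm_sq {ι E : Type*} [NormedAddCommGroup E] [InnerProductSpace ℂ E]
    {v : ι → E} (hv : Orthonormal ℂ v) {a : ι → ℂ} {x : E} (h : HasSum (fun i => a i • v i) x) :
    HasSum (fun i => ‖a i‖ ^ 2) (‖x‖ ^ 2) := by
  have hfin : ∀ s : Finset ι, ‖∑ i ∈ s, a i • v i‖ ^ 2 = ∑ i ∈ s, ‖a i‖ ^ 2 := by
    intro s
    have := hv.inner_sum a a s
    rw [inner_self_eq_norm_sq_to_K] at this
    simp only [Complex.conj_mul'] at this
    exact Complex.ofReal_injective (by push_cast; exact this)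
  have h2 := (Tendsto.norm h).pow 2
  simp only [hfin] at h2
  exact h2

theorem orthonormal_fourierLp_natCast :
    Orthonormal ℂ fun k : ℕ => (fourierLp 2 (k : ℤ) : Lp ℂ 2 circleSigma) :=
  orthonormal_fourier.comp _ Nat.cast_injective

section Abel

variable {f : Lp ℂ 2 circleSigma}

/-- The restriction of the analytic part to the circle of radius `r < 1`. -/
def analyticPartOnCircle (hf : ∀ᵐ t ∂circleSigma, ‖f t‖ ≤ 1) {r : ℝ} (hr0 : 0 ≤ r) (hr : r < 1) :
    C(RieszCircle, ℂ) :=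
  ⟨fun t => analyticPart f (r * fourier 1 t),
    continuous_comp_mul_fourier_one (differentiableOn_analyticPart hf) hr0 hr⟩

theorem hasSum_analyticPartOnCircle (hf : ∀ᵐ t ∂circleSigma, ‖f t‖ ≤ 1) {r : ℝ} (hr0 : 0 ≤ r)
    (hr : r < 1) :
    HasSum (fun k : ℕ => (fourierCoeff f k * (r : ℂ) ^ k) • fourier (k : ℤ))
      (analyticPartOnCircle hf hr0 hr) := by
  have hs : Summable fun k : ℕ =>
      ((fourierCoeff f k * (r : ℂ) ^ k) • fourier (k : ℤ) : C(RieszCircle, ℂ)) := by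
    refine Summable.of_norm_bounded (g := fun k : ℕ => r ^ k)
      (summable_geometric_of_lt_one hr0 hr) fun k => ?_
    rw [norm_smul, fourier_norm, mul_one, norm_mul, norm_pow, Complex.norm_real, Real.norm_eq_abs,
      abs_of_nonneg hr0]
    exact mul_le_of_le_one_left (by positivity) (norm_fourierCoeff_le_one hf k)
  convert hs.hasSum using 1
  ext t
  have := ((ContinuousMap.evalCLM ℂ t).hasSum hs.hasSum).tsum_eq
  change analyticPart f (r * fourier 1 t) = ContinuousMap.evalCLM ℂ t _
  rw [← this, analyticPart]
  congr 1 with k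
  simp only [ContinuousMap.evalCLM_apply, ContinuousMap.smul_apply,
    fourier_natCast_apply, smul_eq_mul]
  ring

theorem hasSum_toLp_analyticPartOnCircle (hf : ∀ᵐ t ∂circleSigma, ‖f t‖ ≤ 1) {r : ℝ}
    (hr0 : 0 ≤ r) (hr : r < 1) :
    HasSum (fun k : ℕ => (fourierCoeff f k * (r : ℂ) ^ k) • fourierLp 2 (k : ℤ))
      (ContinuousMap.toLp (E := ℂ) 2 circleSigma ℂ (analyticPartOnCircle hf hr0 hr)) := by
  have := (ContinuousMap.toLp (E := ℂ) 2 circleSigma ℂ).hasSum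
    (hasSum_analyticPartOnCircle hf hr0 hr)
  simpa [Function.comp_def, fourierLp] using this

/-- Abel summation of the Riesz projection, in `L²`: by orthonormality the squared distance is
`∑ (1 - r ^ k) ^ 2 |f̂(k)| ^ 2`. -/
theorem tendsto_toLp_analyticPartOnCircle (hf : ∀ᵐ t ∂circleSigma, ‖f t‖ ≤ 1) {r : ℕ → ℝ}
    (hr0 : ∀ n, 0 ≤ r n) (hr : ∀ n, r n < 1) (hlim : Tendsto r atTop (𝓝 1)) :
    Tendsto (fun n => ContinuousMap.toLp (E := ℂ) 2 circleSigma ℂ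
      (analyticPartOnCircle hf (hr0 n) (hr n))) atTop (𝓝 (rieszProjection f)) := by
  set G := fun n => ContinuousMap.toLp (E := ℂ) 2 circleSigma ℂ
      (analyticPartOnCircle hf (hr0 n) (hr n))
  have hP := hasSum_rieszProjection f
  have hc := orthonormal_fourierLp_natCast.hasSum_norm_sq hP
  have hD : ∀ n, HasSum (fun k : ℕ => ‖fourierCoeff f k * (1 - (r n : ℂ) ^ k)‖ ^ 2)
      (‖rieszProjection f - G n‖ ^ 2) := fun n => by
    refine orthonormal_fourierLp_natCast.hasSum_norm_sq ?_
    convert hP.sub (hasSum_toLp_analyticPartOnCircle hf (hr0 n) (hr n)) using 2 with k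
    rw [fourierTerm, ← sub_smul]
    congr 1
    ring
  have hsq : Tendsto (fun n => ‖rieszProjection f - G n‖ ^ 2) atTop (𝓝 0) := by
    simp_rw [← fun n => (hD n).tsum_eq]
    rw [← tsum_zero (α := ℝ) (β := ℕ)]
    refine tendsto_tsum_of_dominated_convergence hc.summable (fun k => ?_) (.of_forall fun n k => ?_)
    · have h1 : Tendsto (fun n => (r n : ℂ) ^ k) atTop (𝓝 1) := by
        have := ((Complex.continuous_ofReal.tendsto 1).comp hlim).pow k
        simpa using this
      have h2 := (((tendsto_const_nhds (x := (1 : ℂ))).sub h1).const_mul (fourierCoeff f k)).norm.pow 2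
      simpa using h2
    · have h1 : ‖1 - (r n : ℂ) ^ k‖ ≤ 1 := by
        have h2 : r n ^ k ≤ 1 := pow_le_one₀ (hr0 n) (hr n).le
        have h3 : 0 ≤ r n ^ k := pow_nonneg (hr0 n) k
        rw [← Complex.ofReal_pow, ← Complex.ofReal_one, ← Complex.ofReal_sub, Complex.norm_real,
          Real.norm_eq_abs, abs_of_nonneg (by linarith)]
        linarith
      rw [Real.norm_eq_abs, abs_of_nonneg (by positivity), norm_mul]
      gcongr
      exact mul_le_of_le_one_right (norm_nonneg _) h1
  have hn : Tendsto (fun n => ‖rieszProjection f - G n‖) atTop (𝓝 0) := by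
    have := hsq.sqrt
    simpa using this
  refine tendsto_iff_norm_sub_tendsto_zero.2 ?_
  simpa only [norm_sub_rev] using hn

/-- The Riesz projection is almost everywhere the radial limit of the analytic part, along some
sequence of radii. -/
theorem exists_seq_tendsto_rieszProjection (hf : ∀ᵐ t ∂circleSigma, ‖f t‖ ≤ 1) :
    ∃ r : ℕ → ℝ, (∀ n, 0 ≤ r n) ∧ (∀ n, r n < 1) ∧ Tendsto r atTop (𝓝 1) ∧
      ∀ᵐ t ∂circleSigma, Tendsto (fun n => analyticPart f (r n * fourier 1 t)) atTop
        (𝓝 (rieszProjection f t)) := by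
  set r : ℕ → ℝ := fun n => 1 - 1 / ((n : ℝ) + 1) with hr
  have hr0 : ∀ n, 0 ≤ r n := fun n => by
    rw [hr, sub_nonneg, div_le_one (by positivity)]
    simp
  have hr1 : ∀ n, r n < 1 := fun n => sub_lt_self _ (by positivity)
  have hlim : Tendsto r atTop (𝓝 1) := by
    simpa [hr] using (tendsto_const_nhds (x := (1 : ℝ))).sub (tendsto_one_div_add_atTop_nhds_zero_nat)
  obtain ⟨ns, hns, hae⟩ := (tendstoInMeasure_of_tendsto_Lp
    (tendsto_toLp_analyticPartOnCircle hf hr0 hr1 hlim)).exists_seq_tendsto_ae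
  refine ⟨r ∘ ns, fun n => hr0 _, fun n => hr1 _, hlim.comp hns.tendsto_atTop, ?_⟩
  have hcoe : ∀ᵐ t ∂circleSigma, ∀ n, (ContinuousMap.toLp (E := ℂ) 2 circleSigma ℂ
      (analyticPartOnCircle hf (hr0 n) (hr1 n)) : RieszCircle → ℂ) t
        = analyticPart f (r n * fourier 1 t) :=
    ae_all_iff.2 fun n => ContinuousMap.coeFn_toLp (𝕜 := ℂ) circleSigma _
  filter_upwards [hae, hcoe] with t ht hc
  simpa only [hc, Function.comp_apply] using ht

end Abel

/-! ### The upper bound -/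

theorem ae_norm_le_one_of_eLpNorm_top_le_one {f : RieszCircle → ℂ}
    (hf : eLpNorm f ∞ circleSigma ≤ 1) : ∀ᵐ t ∂circleSigma, ‖f t‖ ≤ 1 := by
  rw [eLpNorm_exponent_top] at hf
  filter_upwards [ae_le_eLpNormEssSup (f := f) (μ := circleSigma)] with t ht
  have := ht.trans hf
  rwa [← ofReal_norm, ENNReal.ofReal_le_one] at this

/-- Exponential integrability of the Riesz projection of bounded functions, for every exponent
below the critical `π`. -/
theorem exists_lintegral_exp_rieszProjection_le {a : ℝ} (ha0 : 0 < a) (ha : a < Real.pi) :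
    ∃ C : ℝ, 0 < C ∧ ∀ f : Lp ℂ 2 circleSigma, eLpNorm f ∞ circleSigma ≤ 1 →
      ∫⁻ t, ENNReal.ofReal (Real.exp (a * ‖rieszProjection f t‖)) ∂circleSigma
        ≤ ENNReal.ofReal C := by
  obtain ⟨C, hC, hbound⟩ := exists_lintegral_exp_analyticPart_le ha0 ha
  refine ⟨C, hC, fun f hf => ?_⟩
  have hf1 := ae_norm_le_one_of_eLpNorm_top_le_one hf
  obtain ⟨r, hr0, hr1, -, hae⟩ := exists_seq_tendsto_rieszProjection hf1
  have hcont : Continuous fun z : ℂ => ENNReal.ofReal (Real.exp (a * ‖z‖)) :=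
    ENNReal.continuous_ofReal.comp (by fun_prop)
  calc _ = ∫⁻ t, liminf (fun n => ENNReal.ofReal
          (Real.exp (a * ‖analyticPart f (r n * fourier 1 t)‖))) atTop ∂circleSigma := by
        refine lintegral_congr_ae ?_
        filter_upwards [hae] with t ht
        exact (((hcont.tendsto _).comp ht).liminf_eq).symm
    _ ≤ liminf (fun n => ∫⁻ t, ENNReal.ofReal
          (Real.exp (a * ‖analyticPart f (r n * fourier 1 t)‖)) ∂circleSigma) atTop :=
        lintegral_liminf_le fun n => (hcont.comp (continuous_comp_mul_fourier_one
          (differentiableOn_analyticPart hf1) (hr0 n) (hr1 n))).measurable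
    _ ≤ ENNReal.ofReal C :=
        liminf_le_of_le (by isBoundedDefault) fun b hb => by
          obtain ⟨n, hn⟩ := hb.exists
          exact hn.trans (hbound f (Lp.aestronglyMeasurable f) hf1 (r n) (hr0 n) (hr1 n))

theorem rpow_le_mul_exp {a p x : ℝ} (ha : 0 < a) (hp : 0 < p) (hx : 0 ≤ x) :
    x ^ p ≤ (p / (a * Real.exp 1)) ^ p * Real.exp (a * x) := by
  have h1 : a * x / p ≤ Real.exp (a * x / p - 1) := by
    have := Real.add_one_le_exp (a * x / p - 1)
    linarith
  have h2 : x ≤ p / (a * Real.exp 1) * Real.exp (a * x / p) := by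
    rw [Real.exp_sub] at h1
    have := mul_le_mul_of_nonneg_left h1 (show 0 ≤ p / a by positivity)
    calc x = p / a * (a * x / p) := by field_simp
      _ ≤ _ := this
      _ = _ := by field_simp
  calc x ^ p ≤ (p / (a * Real.exp 1) * Real.exp (a * x / p)) ^ p := by gcongr
    _ = _ := by
        rw [Real.mul_rpow (by positivity) (by positivity), ← Real.exp_mul]
        congr 2
        field_simp

/-- The upper bound: for every `a < π`, the norm is at most `p / (a e)` times a factor
`C ^ (1 / p)`, which tends to `1`. -/
theorem exists_rieszNorm_top_le {a : ℝ} (ha0 : 0 < a) (ha : a < Real.pi) :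
    ∃ C : ℝ, 0 < C ∧ ∀ p : ℝ, 0 < p →
      rieszNorm ∞ (ENNReal.ofReal p)
        ≤ ENNReal.ofReal (p / (a * Real.exp 1) * C ^ (1 / p)) := by
  obtain ⟨C, hC, hbound⟩ := exists_lintegral_exp_rieszProjection_le ha0 ha
  refine ⟨C, hC, fun p hp => iSup₂_le fun f hf => ?_⟩
  have hp0 : ENNReal.ofReal p ≠ 0 := by simpa using hp
  rw [eLpNorm_eq_lintegral_rpow_enorm_toReal hp0 ENNReal.ofReal_ne_top,
    ENNReal.toReal_ofReal hp.le]
  have hq : 0 ≤ p / (a * Real.exp 1) := by positivity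
  have hint : ∫⁻ t, ‖rieszProjection f t‖ₑ ^ p ∂circleSigma
      ≤ ENNReal.ofReal ((p / (a * Real.exp 1)) ^ p * C) := by
    rw [ENNReal.ofReal_mul (by positivity)]
    calc _ ≤ ∫⁻ t, ENNReal.ofReal ((p / (a * Real.exp 1)) ^ p) *
            ENNReal.ofReal (Real.exp (a * ‖rieszProjection f t‖)) ∂circleSigma := by
          refine lintegral_mono fun t => ?_
          rw [← ofReal_norm, ENNReal.ofReal_rpow_of_nonneg (norm_nonneg _) hp.le,
            ← ENNReal.ofReal_mul (by positivity)]
          exact ENNReal.ofReal_le_ofReal (rpow_le_mul_exp ha0 hp (norm_nonneg _))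
      _ = _ := lintegral_const_mul' _ _ ENNReal.ofReal_ne_top
      _ ≤ _ := by gcongr; exact hbound f hf
  calc _ ≤ ENNReal.ofReal ((p / (a * Real.exp 1)) ^ p * C) ^ (1 / p) := by gcongr
    _ = _ := by
        rw [ENNReal.ofReal_rpow_of_nonneg (by positivity) (by positivity),
          Real.mul_rpow (by positivity) hC.le, ← Real.rpow_mul hq, mul_one_div_cancel hp.ne',
          Real.rpow_one]

/-! ### The sawtooth function and the lower bound -/

/-- The sawtooth function `θ ↦ (π - θ) / π` for `0 < θ ≤ 2π`. -/
def sawtooth : RieszCircle → ℂ :=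
  AddCircle.liftIoc (2 * Real.pi) 0 fun x : ℝ => ((Real.pi : ℂ) - x) / Real.pi

theorem norm_pi_sub_div_pi_le_one {x : ℝ} (hx : x ∈ Set.Ioc 0 (0 + 2 * Real.pi)) :
    ‖((Real.pi : ℂ) - x) / Real.pi‖ ≤ 1 := by
  rw [← Complex.ofReal_sub, ← Complex.ofReal_div, Complex.norm_real, Real.norm_eq_abs, abs_div,
    abs_of_pos Real.pi_pos, div_le_one Real.pi_pos, abs_le]
  constructor <;> linarith [hx.1, hx.2]

theorem norm_sawtooth_le_one (t : RieszCircle) : ‖sawtooth t‖ ≤ 1 := by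
  obtain ⟨x, hx, rfl⟩ := AddCircle.eq_coe_Ioc t
  have hx' : x ∈ Set.Ioc 0 (0 + 2 * Real.pi) := by simpa using hx
  rw [sawtooth, AddCircle.liftIoc_coe_apply hx']
  exact norm_pi_sub_div_pi_le_one hx'

theorem memLp_sawtooth : MemLp sawtooth 2 circleSigma := by
  refine MemLp.haarAddCircle (MemLp.memLp_liftIoc ?_)
  refine MemLp.of_bound (Continuous.aestronglyMeasurable (by fun_prop)) 1 ?_
  exact (ae_restrict_iff' measurableSet_Ioc).2 (.of_forall fun x => norm_pi_sub_div_pi_le_one)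

theorem fourierCoeffOn_const {a b : ℝ} (hab : a < b) (c : ℂ) {n : ℤ} (hn : n ≠ 0) :
    fourierCoeffOn hab (fun _ => c) n = 0 := by
  rw [fourierCoeffOn_of_hasDerivAt hab hn (f' := fun _ => 0) (fun x _ => hasDerivAt_const x c)
    intervalIntegrable_const]
  simp [fourierCoeffOn_eq_integral]

/-- At `n = 0` both sides vanish, the right one through `1 / 0 = 0`. -/
theorem fourierCoeff_sawtooth (n : ℤ) :
    fourierCoeff sawtooth n = 1 / (Real.pi * Complex.I) * (1 / (n : ℂ)) := by
  have hpi : (Real.pi : ℂ) ≠ 0 := by exact_mod_cast Real.pi_ne_zero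
  rw [sawtooth, fourierCoeff_liftIoc_eq]
  rcases eq_or_ne n 0 with rfl | hn
  · have h : ∫ x in (0 : ℝ)..2 * Real.pi, ((Real.pi : ℂ) - x) / Real.pi = 0 := by
      have h1 : ∫ x in (0 : ℝ)..2 * Real.pi, (Real.pi - x) / Real.pi = 0 := by
        rw [intervalIntegral.integral_div, intervalIntegral.integral_sub (by simp) (by simp)]
        simp
        ring
      have h2 := intervalIntegral.integral_ofReal (μ := volume) (a := 0)
        (b := 2 * Real.pi) (f := fun x : ℝ => (Real.pi - x) / Real.pi)
      rw [h1] at h2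
      simpa using h2
    simp [fourierCoeffOn_eq_integral, h]
  · have hn' : (n : ℂ) ≠ 0 := by exact_mod_cast hn
    rw [fourierCoeffOn_of_hasDerivAt _ hn (f' := fun _ => (-1) / (Real.pi : ℂ)) (fun x _ => ?_)
      intervalIntegrable_const, fourierCoeffOn_const _ _ hn]
    · simp only [Complex.ofReal_zero, QuotientAddGroup.mk_zero, fourier_eval_zero]
      push_cast
      field_simp
      ring
    · exact ((Complex.ofRealCLM.hasDerivAt (x := x)).const_sub (Real.pi : ℂ)).div_const _

theorem analyticPart_sawtooth {z : ℂ} (hz : ‖z‖ < 1) :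
    analyticPart sawtooth z = 1 / (Real.pi * Complex.I) * -Complex.log (1 - z) := by
  rw [← ((Complex.hasSum_taylorSeries_neg_log hz).mul_left _).tsum_eq, analyticPart]
  congr 1 with k
  rw [fourierCoeff_sawtooth]
  push_cast
  ring

theorem norm_analyticPart_sawtooth_ge {z : ℂ} (hz : ‖z‖ < 1) :
    Real.pi⁻¹ * -Real.log ‖1 - z‖ ≤ ‖analyticPart sawtooth z‖ := by
  rw [analyticPart_sawtooth hz, norm_mul, norm_neg]
  have h1 : ‖1 / (Real.pi * Complex.I)‖ = Real.pi⁻¹ := by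
    simp [abs_of_pos Real.pi_pos]
  rw [h1]
  gcongr
  rw [← Complex.log_re]
  exact (neg_le_abs _).trans (Complex.abs_re_le_norm _)

theorem norm_one_sub_fourier_one_le (t : RieszCircle) : ‖1 - fourier 1 t‖ ≤ ‖t‖ := by
  have hpi := Real.pi_pos
  set x : ℝ := (AddCircle.equivIoc (2 * Real.pi) (-Real.pi) t : ℝ) with hx
  have hxt : (x : RieszCircle) = t := AddCircle.coe_equivIoc
  have hmem := (AddCircle.equivIoc (2 * Real.pi) (-Real.pi) t).2
  rw [← hx] at hmem
  have hn : ‖(x : RieszCircle)‖ = |x| := by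
    rw [AddCircle.norm_coe_eq_abs_iff _ Real.two_pi_pos.ne', abs_of_pos Real.two_pi_pos, abs_le]
    constructor <;> linarith [hmem.1, hmem.2]
  rw [← hxt, hn, norm_sub_rev, fourier_coe_apply]
  have h2 : (2 * Real.pi * Complex.I * (1 : ℤ) * x / (2 * Real.pi : ℝ) : ℂ) = Complex.I * x := by
    have : (Real.pi : ℂ) ≠ 0 := by exact_mod_cast Real.pi_ne_zero
    push_cast
    field_simp
  rw [h2]
  exact Real.norm_exp_I_mul_ofReal_sub_one_le

theorem circleSigma_closedBall {δ : ℝ} (hδ : δ ≤ Real.pi) :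
    circleSigma (Metric.closedBall 0 δ) = ENNReal.ofReal (δ / Real.pi) := by
  have h := AddCircle.volume_closedBall (T := 2 * Real.pi) (x := 0) δ
  rw [AddCircle.volume_eq_smul_haarAddCircle, Measure.smul_apply, smul_eq_mul,
    min_eq_right (by linarith)] at h
  have h2 : (ENNReal.ofReal (2 * Real.pi)) ≠ 0 := by simp [Real.pi_pos]
  rw [← ENNReal.mul_right_inj h2 ENNReal.ofReal_ne_top, h,
    ← ENNReal.ofReal_mul Real.two_pi_pos.le]
  congr 1
  field_simp

/-- The sawtooth function as an element of `L²`. -/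
def sawtoothLp : Lp ℂ 2 circleSigma := memLp_sawtooth.toLp

theorem coeFn_sawtoothLp : sawtoothLp =ᵐ[circleSigma] sawtooth := memLp_sawtooth.coeFn_toLp

theorem ae_norm_sawtoothLp_le_one : ∀ᵐ t ∂circleSigma, ‖sawtoothLp t‖ ≤ 1 := by
  filter_upwards [coeFn_sawtoothLp] with t ht
  rw [ht]
  exact norm_sawtooth_le_one t

theorem analyticPart_sawtoothLp : analyticPart sawtoothLp = analyticPart sawtooth := by
  ext z
  rw [analyticPart, analyticPart, fourierCoeff_congr_ae coeFn_sawtoothLp]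

/-- The Riesz projection of the sawtooth function is `-(π i)⁻¹ log (1 - ζ)`, which has size
`p / π` at distance `e⁻ᵖ` from `ζ = 1`. -/
theorem ae_le_norm_rieszProjection_sawtoothLp (p : ℝ) :
    ∀ᵐ t ∂circleSigma, ‖t‖ ≤ Real.exp (-p) → p / Real.pi ≤ ‖rieszProjection sawtoothLp t‖ := by
  obtain ⟨r, hr0, hr1, hlim, hae⟩ := exists_seq_tendsto_rieszProjection ae_norm_sawtoothLp_le_one
  filter_upwards [hae] with t ht htp
  have hL : Tendsto (fun n => Real.pi⁻¹ * -Real.log (1 - r n + Real.exp (-p))) atTop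
      (𝓝 (p / Real.pi)) := by
    have h1 : Tendsto (fun n => 1 - r n + Real.exp (-p)) atTop (𝓝 (Real.exp (-p))) := by
      simpa using (hlim.const_sub 1).add_const (Real.exp (-p))
    have h2 := ((h1.log (Real.exp_pos _).ne').neg).const_mul Real.pi⁻¹
    rwa [Real.log_exp, neg_neg, inv_mul_eq_div] at h2
  refine le_of_tendsto_of_tendsto' hL ht.norm fun n => ?_
  have hz : ‖(r n : ℂ) * fourier 1 t‖ < 1 :=
    norm_mul_fourier_lt_one (by simpa [abs_of_nonneg (hr0 n)] using hr1 n) 1 t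
  rw [analyticPart_sawtoothLp]
  refine le_trans ?_ (norm_analyticPart_sawtooth_ge hz)
  have hpos : 0 < ‖1 - (r n : ℂ) * fourier 1 t‖ :=
    norm_pos_iff.2 (one_sub_mul_fourier_ne_zero
      (by simpa [abs_of_nonneg (hr0 n)] using hr1 n) 1 t)
  have hle : ‖1 - (r n : ℂ) * fourier 1 t‖ ≤ 1 - r n + Real.exp (-p) := by
    have h1 : (1 : ℂ) - r n * fourier 1 t = ((1 - r n : ℝ) : ℂ) + r n * (1 - fourier 1 t) := by
      push_cast; ring
    rw [h1]
    refine (norm_add_le _ _).trans ?_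
    rw [norm_mul, Complex.norm_real, Complex.norm_real, Real.norm_eq_abs, Real.norm_eq_abs,
      abs_of_nonneg (hr0 n), abs_of_pos (sub_pos.2 (hr1 n))]
    gcongr
    exact (mul_le_of_le_one_left (norm_nonneg _) (hr1 n).le).trans
      ((norm_one_sub_fourier_one_le t).trans htp)
  have := Real.pi_pos
  gcongr

/-- The lower bound, from Chebyshev's inequality for the Riesz projection of the sawtooth
function at the level `p / π`. -/
theorem le_rieszNorm_top {p : ℝ} (hp : 0 < p) :
    ENNReal.ofReal (p / (Real.pi * Real.exp 1) * Real.pi⁻¹ ^ (1 / p))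
      ≤ rieszNorm ∞ (ENNReal.ofReal p) := by
  have hpi := Real.pi_pos
  have hp0 : ENNReal.ofReal p ≠ 0 := by simpa using hp
  have hnorm : eLpNorm sawtoothLp ∞ circleSigma ≤ 1 := by
    rw [eLpNorm_exponent_top]
    refine eLpNormEssSup_le_of_ae_enorm_bound ?_
    filter_upwards [ae_norm_sawtoothLp_le_one] with t ht
    rwa [← ofReal_norm, ENNReal.ofReal_le_one]
  refine le_trans ?_ (le_iSup₂_of_le sawtoothLp hnorm le_rfl)
  have hch := mul_meas_ge_le_pow_eLpNorm' circleSigma hp0 ENNReal.ofReal_ne_top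
    (Lp.aestronglyMeasurable (rieszProjection sawtoothLp)) (ENNReal.ofReal (p / Real.pi))
  rw [ENNReal.toReal_ofReal hp.le] at hch
  have hball : ENNReal.ofReal (Real.exp (-p) / Real.pi) ≤ circleSigma
      {t | ENNReal.ofReal (p / Real.pi) ≤ ‖rieszProjection sawtoothLp t‖ₑ} := by
    rw [← circleSigma_closedBall (by
      have : Real.exp (-p) ≤ 1 := Real.exp_le_one_iff.2 (by linarith)
      linarith [Real.pi_gt_three])]
    refine measure_mono_ae ?_
    filter_upwards [ae_le_norm_rieszProjection_sawtoothLp p] with t ht hmem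
    change _ ≤ _
    rw [← ofReal_norm]
    exact ENNReal.ofReal_le_ofReal (ht (mem_closedBall_zero_iff.1 hmem))
  rw [← ENNReal.rpow_le_rpow_iff hp]
  refine le_trans (le_of_eq ?_) ((mul_le_mul_right hball _).trans hch)
  rw [ENNReal.ofReal_rpow_of_nonneg (by positivity) hp.le,
    ENNReal.ofReal_rpow_of_nonneg (by positivity) hp.le, ← ENNReal.ofReal_mul (by positivity)]
  congr 1
  rw [Real.mul_rpow (by positivity) (by positivity), ← Real.rpow_mul (by positivity),
    one_div_mul_cancel hp.ne', Real.rpow_one, ← div_div, Real.div_rpow (by positivity) (by positivity),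
    Real.exp_one_rpow, Real.exp_neg]
  ring

/-! ### The limit -/

theorem tendsto_rpow_one_div_atTop {C : ℝ} (hC : 0 < C) :
    Tendsto (fun p : ℝ => C ^ (1 / p)) atTop (𝓝 1) := by
  have h : Tendsto (fun p : ℝ => 1 / p) atTop (𝓝 0) := by
    simpa using tendsto_inv_atTop_zero (𝕜 := ℝ)
  simpa using (tendsto_const_nhds (x := C)).rpow h (Or.inl hC.ne')

end

theorem theorem2 :
    (∀ p : ℝ, 2 ≤ p → rieszNorm ∞ (ENNReal.ofReal p) < ∞) ∧
    Tendsto (fun p : ℝ => p⁻¹ * (rieszNorm ∞ (ENNReal.ofReal p)).toReal) atTop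
      (𝓝 (1 / (Real.pi * Real.exp 1))) := by
  have hpi := Real.pi_pos
  have hfin : ∀ p : ℝ, 0 < p → rieszNorm ∞ (ENNReal.ofReal p) < ∞ := fun p hp => by
    obtain ⟨C, -, hC⟩ := exists_rieszNorm_top_le one_pos (by linarith [Real.pi_gt_three])
    exact (hC p hp).trans_lt ENNReal.ofReal_lt_top
  refine ⟨fun p hp => hfin p (by linarith), tendsto_order.2 ⟨fun b hb => ?_, fun b hb => ?_⟩⟩
  · have hlim := (tendsto_rpow_one_div_atTop (inv_pos.2 hpi)).const_mul
      (1 / (Real.pi * Real.exp 1))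
    rw [mul_one] at hlim
    filter_upwards [hlim.eventually (lt_mem_nhds hb), eventually_gt_atTop 0] with p hbp hp
    refine hbp.trans_le ?_
    have h := (ENNReal.ofReal_le_iff_le_toReal (hfin p hp).ne).1 (le_rieszNorm_top hp)
    have h' := mul_le_mul_of_nonneg_left h (inv_nonneg.2 hp.le)
    refine le_trans (le_of_eq ?_) h'
    field_simp
  · -- Take `a < π` with `1 / (a e)` still below `b`.
    have hcont : Tendsto (fun a : ℝ => 1 / (a * Real.exp 1)) (𝓝[<] Real.pi)
        (𝓝 (1 / (Real.pi * Real.exp 1))) := by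
      refine ContinuousAt.continuousWithinAt (ContinuousAt.div (by fun_prop) (by fun_prop) ?_)
      positivity
    obtain ⟨a, hab, ha0, ha⟩ := ((hcont.eventually (gt_mem_nhds hb)).and
      (Ioo_mem_nhdsLT hpi)).exists
    obtain ⟨C, hC0, hC⟩ := exists_rieszNorm_top_le ha0 ha
    have hlim := (tendsto_rpow_one_div_atTop hC0).const_mul (1 / (a * Real.exp 1))
    rw [mul_one] at hlim
    filter_upwards [hlim.eventually (gt_mem_nhds hab), eventually_gt_atTop 0] with p hbp hp
    refine lt_of_le_of_lt ?_ hbp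
    have h := ENNReal.toReal_le_of_le_ofReal (by positivity) (hC p hp)
    have h' := mul_le_mul_of_nonneg_left h (inv_nonneg.2 hp.le)
    refine h'.trans (le_of_eq ?_)
    field_simp
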